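/- For positive integers $s_1,\dots,s_r$ with $s_1>1$ let $$\zeta^\star(s_1,\dots,s_r)=\sum_{k_1\ge\cdots\ge k_r\ge1}\frac{1}{k_1^{s_1}\cdots k_r^{s_r}}$$ be the (convergent) multiple zeta star value, let $\{2\}^a$ denote $a$ successive entries equal to $2$, and let $B_n$ be the Bernoulli numbers. Then for each positive integer $m$, $$\zeta^\star(\{2\}^{m-1},3,\{2\}^{m-1},1)=2\pi^{4m}\left(\frac{(1-2^{2m-1})B_{2m}}{(2m)!}\right)^2,$$ $$\zeta^\star(\{2\}^{m-1},3,\{2\}^{m-1},1,\{2\}^m)=(-1)^{m+1}\frac{\pi^{6m}}{3}\left(\frac{(2^{2m}-2)^3B_{2m}^3}{2\cdot(2m)!^3}+\frac{(2^{6m}-2)B_{6m}}{(6m)!}\right),$$ $$\zeta^\star(\{2\}^{m-1},3,\{2\}^{m-1},1,\{2\}^{m-1},3,\{2\}^{m-1},1)=\frac{(2-2^{2m})B_{2m}\,\pi^{8m}}{3\cdot(2m)!}\left(\frac{(1-2^{2m-1})^3B_{2m}^3}{(2m)!^3}+\frac{(2-2^{6m})B_{6m}}{(6m)!}\right).$$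 -/

import Mathlib

/-- The index set `k₁ ≥ k₂ ≥ ⋯ ≥ k_r ≥ 1` of the series of a multiple zeta star value of depth
`r`. -/
abbrev StarIndex (r : ℕ) : Type := {k : Fin r → ℕ+ // Antitone k}

/-- The term `1 / (k₁ ^ s₁ ⋯ k_r ^ s_r)` of the series of `ζ⋆(s₁, …, s_r)`. -/
noncomputable def mzsvTerm (s : List ℕ) (k : StarIndex s.length) : ℝ :=
  1 / ∏ i : Fin s.length, ((k.1 i : ℕ) : ℝ) ^ s.get i

/-- The multiple zeta star value `ζ⋆(s₁, …, s_r)`. -/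
noncomputable def mzsv (s : List ℕ) : ℝ :=
  ∑' k : StarIndex s.length, mzsvTerm s k

/-- The string `{2}^{m-1}, 3, {2}^{m-1}, 1` (used for `m ≥ 1`). -/
def block321 (m : ℕ) : List ℕ :=
  List.replicate (m - 1) 2 ++ [3] ++ List.replicate (m - 1) 2 ++ [1]

/-! The kernel `n! ^ 2 / ((n - k)! (n + k)!)` turns the outer summations of a truncated star value
into elementary operations: if `S_n = ∑_{k ≤ n} g_k n! ^ 2 / ((n - k)! (n + k)!)` for all `n ≥ 1`,
then prepending an entry `2` to the index divides `g_k` by `k ^ 2`, while entries `1` and `3`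
exchange, via Abel summation, a sequence of sums `G_{k-1} + G_k` with a sequence of increments.
Starting from `1 = 2 ∑_{k ≤ n} (-1) ^ (k - 1) n! ^ 2 / ((n - k)! (n + k)!)`, the block
`{2}^{m-1}, 3, {2}^{m-1}, 1` thus applies twice the recursion that defines the Schur functions `q_d`
of the variables `x_k = (-1) ^ (k - 1) / k ^ (2m)`, and raises `d` by two. The empty index
corresponds to `q₀ = 1` and `{2}^m` to `q₁`.

As `n → ∞` the kernel tends to `1`, so the three values are the limits of `q₂`, `q₃` and `q₄`. In
terms of the power sums `p₁` and `p₃`, which converge to `η(2m)` and `η(6m)`, these are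
`q₂ = 2 p₁ ^ 2`, `3 q₃ = 4 p₁ ^ 3 + 2 p₃` and `3 q₄ = 2 p₁ ^ 4 + 4 p₁ p₃`. -/

open Filter Topology

/-! ### Multiple zeta star values as limits of truncated sums -/

/-- The truncated multiple zeta star value `∑_{n ≥ k₁ ≥ ⋯ ≥ k_r ≥ 1} 1 / (k₁ ^ s₁ ⋯ k_r ^ s_r)`, by
recursion on the largest index `k₁ = i + 1`. -/
noncomputable def starSum : List ℕ → ℕ → ℝ
  | [], _ => 1
  | s :: l, n => ∑ i ∈ Finset.range n, 1 / ((i : ℝ) + 1) ^ s * starSum l (i + 1)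

lemma starSum_cons_succ (s : ℕ) (l : List ℕ) (n : ℕ) :
    starSum (s :: l) (n + 1) =
      starSum (s :: l) n + 1 / ((n : ℝ) + 1) ^ s * starSum l (n + 1) :=
  Finset.sum_range_succ _ n

lemma hasSum_of_tendsto_hasSum_subtype {α ι : Type*} {F : Filter ι} [F.NeBot] {f : α → ℝ}
    (hf : ∀ a, 0 ≤ f a) {A : ι → Set α} (hA : ∀ a, ∀ᶠ n in F, a ∈ A n) {S : ι → ℝ}
    (hS : ∀ n, HasSum (f ∘ ((↑) : A n → α)) (S n)) {L : ℝ} (hL : Tendsto S F (𝓝 L)) :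
    HasSum f L := by
  have hind (n : ι) : HasSum ((A n).indicator f) (S n) := hasSum_subtype_iff_indicator.1 (hS n)
  have hev (a : α) : ∀ᶠ n in F, (A n).indicator f a = f a :=
    (hA a).mono fun n hn => Set.indicator_of_mem hn f
  have hsum : Summable f := by
    refine summable_of_sum_le hf fun u => ge_of_tendsto hL ?_
    filter_upwards [(eventually_all_finset u).2 fun a _ => hev a] with n hn
    rw [← Finset.sum_congr rfl hn]
    exact sum_le_hasSum u (fun a _ => Set.indicator_nonneg (fun a _ => hf a) a) (hind n)
  have hlim : Tendsto (fun n => ∑' a, (A n).indicator f a) F (𝓝 (∑' a, f a)) :=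
    tendsto_tsum_of_dominated_convergence hsum
      (fun a => tendsto_const_nhds.congr' ((hev a).mono fun _ => Eq.symm))
      (Eventually.of_forall fun n a => (norm_indicator_le_norm_self f a).trans_eq
        (Real.norm_of_nonneg (hf a)))
  simp only [(hind _).tsum_eq] at hlim
  exact tendsto_nhds_unique hL hlim ▸ hsum.hasSum

lemma antitone_fin_cons {α : Type*} [Preorder α] {r : ℕ} {f : Fin r → α} {a : α} :
    Antitone (Fin.cons a f : Fin (r + 1) → α) ↔ (∀ i, f i ≤ a) ∧ Antitone f := by
  rw [antitone_iff_forall_lt, antitone_iff_forall_lt]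
  exact Fin.liftFun_cons (· ≥ ·)

/-- The indices `N ≥ k₁ ≥ ⋯ ≥ k_r ≥ 1` of the truncated series. -/
def boundedStarIndex (r N : ℕ) : Set (StarIndex r) := {k | ∀ i, (k.1 i : ℕ) ≤ N}

lemma mem_boundedStarIndex_succ {r N : ℕ} {k : StarIndex (r + 1)} :
    k ∈ boundedStarIndex (r + 1) N ↔ (k.1 0 : ℕ) ≤ N :=
  ⟨fun h => h 0, fun h i => le_trans (k.2 (Fin.zero_le i)) h⟩

lemma boundedStarIndex_succ (r N : ℕ) :
    boundedStarIndex (r + 1) (N + 1) =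
      boundedStarIndex (r + 1) N ∪ {k | k.1 0 = N.succPNat} := by
  ext k
  simp only [Set.mem_union, mem_boundedStarIndex_succ, Set.mem_ofPred_eq, ← PNat.coe_inj,
    Nat.succPNat_coe]
  omega

lemma disjoint_boundedStarIndex_head_eq {r N : ℕ} :
    Disjoint (boundedStarIndex (r + 1) N) {k | k.1 0 = N.succPNat} := by
  refine Set.disjoint_left.2 fun k hk hhead => ?_
  rw [mem_boundedStarIndex_succ] at hk
  rw [Set.mem_ofPred_eq, ← PNat.coe_inj, Nat.succPNat_coe] at hhead
  omega

lemma eventually_mem_boundedStarIndex {r : ℕ} (k : StarIndex r) :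
    ∀ᶠ N in atTop, k ∈ boundedStarIndex r N :=
  eventually_all.2 fun i => eventually_ge_atTop (k.1 i : ℕ)

/-- Prepending a largest index `a`. -/
def boundedStarIndexEquiv (r : ℕ) (a : ℕ+) :
    boundedStarIndex r a ≃ {k : StarIndex (r + 1) | k.1 0 = a} where
  toFun k := ⟨⟨Fin.cons a k.1.1, antitone_fin_cons.2 ⟨k.2, k.1.2⟩⟩, rfl⟩
  invFun k := ⟨⟨Fin.tail k.1.1, fun _ _ h => k.1.2 (Fin.succ_le_succ_iff.2 h)⟩,
    fun i => (k.1.2 (Fin.zero_le i.succ)).trans_eq k.2⟩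
  left_inv _ := rfl
  right_inv k := by
    obtain ⟨k, rfl⟩ := k
    exact Subtype.ext (Subtype.ext (Fin.cons_self_tail k.1))

lemma mzsvTerm_nonneg (s : List ℕ) (k : StarIndex s.length) : 0 ≤ mzsvTerm s k := by
  unfold mzsvTerm
  positivity

lemma mzsvTerm_boundedStarIndexEquiv (s : ℕ) (l : List ℕ) (a : ℕ+)
    (k : boundedStarIndex l.length a) :
    mzsvTerm (s :: l) (boundedStarIndexEquiv l.length a k).1 =
      1 / ((a : ℕ) : ℝ) ^ s * mzsvTerm l k.1 := by
  rw [mzsvTerm, mzsvTerm, one_div_mul_one_div]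
  exact congrArg (1 / ·) (Fin.prod_univ_succ _)

lemma hasSum_mzsvTerm_head_eq (s : ℕ) {l : List ℕ} {a : ℕ+} {S : ℝ}
    (h : HasSum (mzsvTerm l ∘ ((↑) : boundedStarIndex l.length a → StarIndex l.length)) S) :
    HasSum (mzsvTerm (s :: l) ∘ ((↑) : {k : StarIndex (l.length + 1) | k.1 0 = a} → _))
      (1 / ((a : ℕ) : ℝ) ^ s * S) := by
  refine (boundedStarIndexEquiv l.length a).hasSum_iff.1 ?_
  exact (h.mul_left _).congr_fun fun k => (mzsvTerm_boundedStarIndexEquiv s l a k)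

lemma hasSum_mzsvTerm_boundedStarIndex (l : List ℕ) (N : ℕ) :
    HasSum (mzsvTerm l ∘ ((↑) : boundedStarIndex l.length N → StarIndex l.length))
      (starSum l N) := by
  induction l generalizing N with
  | nil =>
    have : Unique (boundedStarIndex ([] : List ℕ).length N) :=
      ⟨⟨⟨⟨fun i => i.elim0, fun i => i.elim0⟩, fun i => i.elim0⟩⟩,
        fun k => Subtype.ext (Subtype.ext (funext fun i => i.elim0))⟩
    simpa [starSum, mzsvTerm] using
      hasSum_unique (mzsvTerm [] ∘ ((↑) : boundedStarIndex ([] : List ℕ).length N → _))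
  | cons s l hl =>
    induction N with
    | zero =>
      have : IsEmpty (boundedStarIndex (s :: l).length 0) :=
        ⟨fun k => (k.1.1 0).ne_zero (Nat.le_zero.1 (k.2 0))⟩
      exact hasSum_empty
    | succ N hN =>
      have hhead := hasSum_mzsvTerm_head_eq s (hl N.succPNat)
      rw [Nat.succPNat_coe, Nat.cast_succ] at hhead
      have hunion : boundedStarIndex (s :: l).length (N + 1) = _ :=
        boundedStarIndex_succ l.length N
      rw [starSum_cons_succ, hunion]
      exact hN.add_disjoint disjoint_boundedStarIndex_head_eq hhead

lemma hasSum_mzsvTerm_of_tendsto_starSum {l : List ℕ} {L : ℝ}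
    (h : Tendsto (starSum l) atTop (𝓝 L)) : HasSum (mzsvTerm l) L :=
  hasSum_of_tendsto_hasSum_subtype (mzsvTerm_nonneg l) eventually_mem_boundedStarIndex
    (hasSum_mzsvTerm_boundedStarIndex l) h

/-! ### The binomial kernel -/

/-- The kernel `n! ^ 2 / ((n - k)! (n + k)!)`, which vanishes for `k > n`. -/
noncomputable def binomKernel (n k : ℕ) : ℝ := n.descFactorial k / (n + 1).ascFactorial k

lemma binomKernel_zero_right (n : ℕ) : binomKernel n 0 = 1 := by simp [binomKernel]

lemma binomKernel_eq_zero {n k : ℕ} (h : n < k) : binomKernel n k = 0 := by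
  simp [binomKernel, Nat.descFactorial_eq_zero_iff_lt.2 h]

lemma binomKernel_nonneg (n k : ℕ) : 0 ≤ binomKernel n k := by
  unfold binomKernel
  positivity

lemma binomKernel_le_one (n k : ℕ) : binomKernel n k ≤ 1 := by
  refine div_le_one_of_le₀ ?_ (Nat.cast_nonneg _)
  exact_mod_cast (n.descFactorial_le_pow k).trans
    ((Nat.pow_le_pow_left n.le_succ k).trans ((n + 1).pow_succ_le_ascFactorial k))

lemma binomKernel_succ_right (n k : ℕ) :
    binomKernel n (k + 1) = binomKernel n k * (((n : ℝ) - k) / (n + k + 1)) := by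
  rcases lt_or_ge n k with h | h
  · simp [binomKernel_eq_zero h, binomKernel_eq_zero (h.trans k.lt_succ_self)]
  · rw [binomKernel, binomKernel, Nat.descFactorial_succ, Nat.ascFactorial_succ, div_mul_div_comm]
    push_cast [h]
    ring_nf

lemma binomKernel_succ_left_mul (n k : ℕ) :
    binomKernel (n + 1) k * (((n : ℝ) + 1) ^ 2 - (k : ℝ) ^ 2) =
      binomKernel n k * ((n : ℝ) + 1) ^ 2 := by
  induction k with
  | zero => simp [binomKernel_zero_right]
  | succ k ih =>
    rw [binomKernel_succ_right, binomKernel_succ_right]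
    push_cast
    field_simp
    linear_combination ((n : ℝ) - k) * ((n : ℝ) + 1 + k + 1) * ih

lemma tendsto_binomKernel (k : ℕ) : Tendsto (binomKernel · k) atTop (𝓝 1) := by
  induction k with
  | zero => simp [binomKernel_zero_right]
  | succ k ih =>
    have hratio : Tendsto (fun n : ℕ => ((n : ℝ) - k) / (n + k + 1)) atTop (𝓝 1) := by
      convert tendsto_add_mul_div_add_mul_atTop_nhds (-(k : ℝ)) (k + 1) 1 one_ne_zero using 2
      · ring
      · exact (div_one 1).symm
    simpa [binomKernel_succ_right] using ih.mul hratio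

/-- The transform `∑_{k = 1}^n g_k n! ^ 2 / ((n - k)! (n + k)!)`, with `g_k` stored as
`g (k - 1)`. -/
noncomputable def kernelSum (g : ℕ → ℝ) (n : ℕ) : ℝ :=
  ∑ i ∈ Finset.range n, g i * binomKernel n (i + 1)

/-- The binomial kernel applied to the increments of `G`, including the initial increment `G 0`
against `binomKernel n 0 = 1`. By Abel summation this is a weighted mean of `G 0, …, G n`. -/
noncomputable def kernelMean (G : ℕ → ℝ) (n : ℕ) : ℝ :=
  G 0 + kernelSum (fun i => G (i + 1) - G i) n

lemma kernelSum_succ_sub (h : ℕ → ℝ) (n : ℕ) :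
    (kernelSum (fun i => h i / ((i : ℝ) + 1) ^ 2) (n + 1) -
        kernelSum (fun i => h i / ((i : ℝ) + 1) ^ 2) n) * ((n : ℝ) + 1) ^ 2 =
      kernelSum h (n + 1) := by
  have hextend : kernelSum (fun i => h i / ((i : ℝ) + 1) ^ 2) n =
      ∑ i ∈ Finset.range (n + 1), h i / ((i : ℝ) + 1) ^ 2 * binomKernel n (i + 1) := by
    rw [Finset.sum_range_succ, binomKernel_eq_zero n.lt_succ_self, mul_zero, add_zero, kernelSum]
  rw [hextend, kernelSum, kernelSum, ← Finset.sum_sub_distrib, Finset.sum_mul]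
  refine Finset.sum_congr rfl fun i _ => ?_
  have hrec := binomKernel_succ_left_mul n (i + 1)
  push_cast at hrec
  field_simp
  linear_combination h i * hrec

lemma kernelSum_mul_add_succ (G : ℕ → ℝ) (n : ℕ) :
    kernelSum (fun i => ((i : ℝ) + 1) * (G i + G (i + 1))) n = n * kernelMean G n := by
  have hpartial (j : ℕ) : ∑ i ∈ Finset.range j,
      (((i : ℝ) + 1) * (G i + G (i + 1)) - n * (G (i + 1) - G i)) * binomKernel n (i + 1) =
      n * G 0 - ((n : ℝ) - j) * binomKernel n j * G j := by
    induction j with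
    | zero => simp [binomKernel_zero_right]
    | succ j ih =>
      rw [Finset.sum_range_succ, ih, binomKernel_succ_right]
      push_cast
      field_simp
      ring
  have htotal := hpartial n
  simp only [sub_mul _ ((n : ℝ) * _), mul_assoc (n : ℝ), Finset.sum_sub_distrib,
    ← Finset.mul_sum, sub_self, zero_mul, sub_zero] at htotal
  rw [kernelMean, kernelSum, kernelSum]
  linarith

lemma tendsto_kernelMean {G : ℕ → ℝ} (hG : Summable fun i => G (i + 1) - G i) {L : ℝ}
    (hL : Tendsto G atTop (𝓝 L)) : Tendsto (kernelMean G) atTop (𝓝 L) := by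
  have hlim : Tendsto (fun n => ∑' i, (G (i + 1) - G i) * binomKernel n (i + 1)) atTop
      (𝓝 (∑' i, (G (i + 1) - G i))) := by
    refine tendsto_tsum_of_dominated_convergence hG.abs (fun i => ?_)
      (Eventually.of_forall fun n i => ?_)
    · simpa using (tendsto_binomKernel (i + 1)).const_mul (G (i + 1) - G i)
    · rw [norm_mul, Real.norm_of_nonneg (binomKernel_nonneg n _)]
      exact mul_le_of_le_one_right (norm_nonneg _) (binomKernel_le_one n _)
  have htelescope : ∑' i, (G (i + 1) - G i) = L - G 0 := by
    refine tendsto_nhds_unique hG.hasSum.tendsto_sum_nat ?_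
    simpa only [Finset.sum_range_sub] using hL.sub_const (G 0)
  rw [htelescope] at hlim
  have hfinite (n : ℕ) : ∑' i, (G (i + 1) - G i) * binomKernel n (i + 1) =
      kernelSum (fun i => G (i + 1) - G i) n :=
    tsum_eq_sum fun i hi => by
      rw [binomKernel_eq_zero (by simpa [Nat.lt_succ_iff] using hi), mul_zero]
  simp only [hfinite] at hlim
  have hmean : Tendsto (kernelMean G) atTop (𝓝 (G 0 + (L - G 0))) := hlim.const_add (G 0)
  rwa [add_sub_cancel] at hmean

/-! ### Kernel representations of truncated star values -/

/-- The truncated star values of `l` are the kernel sums of `g`. The truncation at `0` is excluded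
because there every kernel sum vanishes, while that of the empty list is `1`. -/
def HasKernelSum (l : List ℕ) (g : ℕ → ℝ) : Prop :=
  ∀ n, starSum l (n + 1) = kernelSum g (n + 1)

/-- The truncated star values of `l` are the kernel means of `G`. -/
def HasKernelMean (l : List ℕ) (G : ℕ → ℝ) : Prop :=
  ∀ n, starSum l (n + 1) = kernelMean G (n + 1)

lemma HasKernelSum.hasKernelMean {l : List ℕ} {G : ℕ → ℝ} (hG : G 0 = 0)
    (h : HasKernelSum l fun i => G (i + 1) - G i) : HasKernelMean l G := fun n => by
  rw [h n, kernelMean, hG, zero_add]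

lemma hasKernelSum_nil : HasKernelSum [] fun i => 2 * (-1) ^ i := fun n => by
  have hcancel (i : ℕ) : (-1 : ℝ) ^ i + (-1) ^ (i + 1) = 0 := by ring
  have hincrement (i : ℕ) : (-1 : ℝ) ^ (i + 1) - (-1) ^ i = -(2 * (-1) ^ i) := by ring
  have hmean := kernelSum_mul_add_succ (fun i => (-1) ^ i) (n + 1)
  simp only [kernelMean, kernelSum, hcancel, hincrement, mul_zero, zero_mul, neg_mul,
    Finset.sum_neg_distrib, Finset.sum_const_zero, pow_zero] at hmean
  have hone := (mul_eq_zero.1 hmean.symm).resolve_left (by positivity)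
  rw [starSum, kernelSum]
  linarith

lemma HasKernelMean.hasSum_mzsvTerm {l : List ℕ} {G : ℕ → ℝ} (h : HasKernelMean l G)
    (hG : Summable fun i => G (i + 1) - G i) {L : ℝ} (hL : Tendsto G atTop (𝓝 L)) :
    HasSum (mzsvTerm l) L := by
  refine hasSum_mzsvTerm_of_tendsto_starSum ((tendsto_add_atTop_iff_nat 1).1 ?_)
  exact ((tendsto_add_atTop_iff_nat 1).2 (tendsto_kernelMean hG hL)).congr fun n => (h n).symm

lemma hasKernelSum_cons {s : ℕ} {l : List ℕ} {h : ℕ → ℝ}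
    (hh : ∀ n : ℕ, ((n : ℝ) + 1) ^ s * kernelSum h (n + 1) =
      ((n : ℝ) + 1) ^ 2 * starSum l (n + 1)) :
    HasKernelSum (s :: l) fun i => h i / ((i : ℝ) + 1) ^ 2 := by
  suffices ∀ n, starSum (s :: l) n = kernelSum (fun i => h i / ((i : ℝ) + 1) ^ 2) n from
    fun n => this (n + 1)
  intro n
  induction n with
  | zero => simp [starSum, kernelSum]
  | succ n ih =>
    have hstep := hh n
    rw [← kernelSum_succ_sub] at hstep
    rw [starSum_cons_succ, ih]
    field_simp
    apply mul_left_cancel₀ (show ((n : ℝ) + 1) ^ 2 ≠ 0 by positivity)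
    linear_combination -hstep

lemma HasKernelMean.cons_one {l : List ℕ} {G : ℕ → ℝ} (hG : HasKernelMean l G) :
    HasKernelSum (1 :: l) fun i => (G i + G (i + 1)) / ((i : ℝ) + 1) := by
  convert hasKernelSum_cons (h := fun i => ((i : ℝ) + 1) * (G i + G (i + 1))) fun n => ?_ using 2
  · field_simp
  · rw [kernelSum_mul_add_succ, hG]
    push_cast
    ring

lemma HasKernelSum.cons_two {l : List ℕ} {g : ℕ → ℝ} (hg : HasKernelSum l g) :
    HasKernelSum (2 :: l) fun i => g i / ((i : ℝ) + 1) ^ 2 :=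
  hasKernelSum_cons fun n => by rw [hg]

lemma HasKernelSum.replicate_two_append {l : List ℕ} {g : ℕ → ℝ} (hg : HasKernelSum l g)
    (a : ℕ) :
    HasKernelSum (List.replicate a 2 ++ l) fun i => g i / ((i : ℝ) + 1) ^ (2 * a) := by
  induction a with
  | zero => simpa using hg
  | succ a ih =>
    rw [List.replicate_succ, List.cons_append]
    convert ih.cons_two using 2
    rw [div_div]
    ring

lemma HasKernelSum.cons_three {l : List ℕ} {H : ℕ → ℝ} (hH₀ : H 0 = 0)
    (hH : HasKernelSum l fun i => ((i : ℝ) + 1) * (H i + H (i + 1))) :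
    HasKernelSum (3 :: l) fun i => (H (i + 1) - H i) / ((i : ℝ) + 1) ^ 2 :=
  hasKernelSum_cons fun n => by
    rw [hH, kernelSum_mul_add_succ, kernelMean, hH₀]
    push_cast
    ring

/-- The term `(-1) ^ (k - 1) / k ^ (2 * m)` of the Dirichlet eta series of `η(2m)`, with
`k = i + 1`. -/
noncomputable def etaTerm (m i : ℕ) : ℝ := (-1) ^ i / ((i : ℝ) + 1) ^ (2 * m)

-- The entry `3` needs `H i + H (i + 1)` while the hypothesis provides `P (i + 1) - P i`:
-- `H i = (-1) ^ (i + 1) * P i` exchanges the two, and differences of `H` give back sums of `P`.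
lemma HasKernelMean.replicate_two_three_replicate_two_one_append {l : List ℕ} {G P : ℕ → ℝ}
    (hG : HasKernelMean l G) (a b : ℕ) (hP₀ : P 0 = 0)
    (hP : ∀ i, P (i + 1) - P i = etaTerm (b + 1) i * (G i + G (i + 1))) :
    HasKernelSum (List.replicate a 2 ++ 3 :: (List.replicate b 2 ++ 1 :: l))
      fun i => etaTerm (a + 1) i * (P i + P (i + 1)) := by
  have hthree : HasKernelSum (3 :: (List.replicate b 2 ++ 1 :: l))
      fun i => ((-1) ^ (i + 1 + 1) * P (i + 1) - (-1) ^ (i + 1) * P i) / ((i : ℝ) + 1) ^ 2 := by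
    refine HasKernelSum.cons_three (H := fun i => (-1) ^ (i + 1) * P i) (by simp [hP₀]) ?_
    convert hG.cons_one.replicate_two_append b using 2 with i
    calc
      ((i : ℝ) + 1) * ((-1) ^ (i + 1) * P i + (-1) ^ (i + 1 + 1) * P (i + 1))
      _ = ((i : ℝ) + 1) * ((-1) ^ i * (P (i + 1) - P i)) := by ring
      _ = (-1) ^ i * (-1) ^ i * ((G i + G (i + 1)) / ((i : ℝ) + 1) / ((i : ℝ) + 1) ^ (2 * b)) := by
        rw [hP, etaTerm]
        field_simp
        ring
      _ = (G i + G (i + 1)) / ((i : ℝ) + 1) / ((i : ℝ) + 1) ^ (2 * b) := by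
        rw [← mul_pow, neg_one_mul, neg_neg, one_pow, one_mul]
  convert hthree.replicate_two_append a using 2 with i
  rw [etaTerm]
  field_simp
  ring

/-! ### Schur `Q`-functions -/

/-- The Schur function `q_d(x₀, …, x_{n-1})`, the coefficient of `t ^ d` in
`∏ i < n, (1 + x_i t) / (1 - x_i t)`. The recursion is multiplication of that product by the `n`-th
factor: `q_d(n + 1) - x_n q_{d-1}(n + 1) = q_d(n) + x_n q_{d-1}(n)`. -/
def schurQ {R : Type*} [CommSemiring R] (x : ℕ → R) : ℕ → ℕ → R
  | 0, _ => 1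
  | d + 1, n => ∑ i ∈ Finset.range n, x i * (schurQ x d i + schurQ x d (i + 1))

section CommSemiring

variable {R : Type*} [CommSemiring R] (x : ℕ → R) (d n : ℕ)

lemma schurQ_succ_zero : schurQ x (d + 1) 0 = 0 := Finset.sum_range_zero _

lemma schurQ_succ_succ : schurQ x (d + 1) (n + 1) =
    schurQ x (d + 1) n + x n * (schurQ x d n + schurQ x d (n + 1)) :=
  Finset.sum_range_succ _ n

lemma schurQ_one : schurQ x 1 n = 2 * ∑ i ∈ Finset.range n, x i := by
  simp only [schurQ, one_add_one_eq_two, ← Finset.sum_mul, mul_comm]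

lemma schurQ_two : schurQ x 2 n = 2 * (∑ i ∈ Finset.range n, x i) ^ 2 := by
  induction n with
  | zero => simp [schurQ_succ_zero]
  | succ n ih =>
    rw [schurQ_succ_succ, ih, schurQ_one, schurQ_one, Finset.sum_range_succ]
    ring

lemma three_mul_schurQ_three : 3 * schurQ x 3 n =
    4 * (∑ i ∈ Finset.range n, x i) ^ 3 + 2 * ∑ i ∈ Finset.range n, x i ^ 3 := by
  induction n with
  | zero => simp [schurQ_succ_zero]
  | succ n ih =>
    rw [schurQ_succ_succ, mul_add, ih, schurQ_two, schurQ_two]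
    simp only [Finset.sum_range_succ]
    ring

lemma three_mul_schurQ_four : 3 * schurQ x 4 n =
    2 * (∑ i ∈ Finset.range n, x i) ^ 4 +
      4 * (∑ i ∈ Finset.range n, x i) * ∑ i ∈ Finset.range n, x i ^ 3 := by
  induction n with
  | zero => simp [schurQ_succ_zero]
  | succ n ih =>
    rw [schurQ_succ_succ, mul_add, ih, mul_left_comm, mul_add 3, three_mul_schurQ_three,
      three_mul_schurQ_three]
    simp only [Finset.sum_range_succ]
    ring

end CommSemiring

lemma schurQ_succ_sub {R : Type*} [CommRing R] (x : ℕ → R) (d n : ℕ) :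
    schurQ x (d + 1) (n + 1) - schurQ x (d + 1) n = x n * (schurQ x d n + schurQ x d (n + 1)) := by
  rw [schurQ_succ_succ, add_sub_cancel_left]

lemma summable_mul_of_tendsto {x u : ℕ → ℝ} (hx : Summable x) {L : ℝ}
    (hu : Tendsto u atTop (𝓝 L)) : Summable fun i => x i * u i :=
  summable_of_isBigO_nat hx <| by
    simpa using (Asymptotics.isBigO_refl x atTop).mul (hu.isBigO_one ℝ)

lemma summable_mul_schurQ_add {x : ℕ → ℝ} (hx : Summable x) (d : ℕ) :
    Summable fun i => x i * (schurQ x d i + schurQ x d (i + 1)) := by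
  induction d with
  | zero => exact hx.mul_right (1 + 1)
  | succ d ih =>
    have hlim := ih.hasSum.tendsto_sum_nat
    exact summable_mul_of_tendsto hx (hlim.add ((tendsto_add_atTop_iff_nat 1).2 hlim))

lemma HasKernelMean.hasSum_mzsvTerm_of_schurQ {l : List ℕ} {x : ℕ → ℝ} {d : ℕ}
    (h : HasKernelMean l (schurQ x (d + 1))) (hx : Summable x) {L : ℝ}
    (hL : Tendsto (schurQ x (d + 1)) atTop (𝓝 L)) : HasSum (mzsvTerm l) L :=
  h.hasSum_mzsvTerm (by simpa only [schurQ_succ_sub] using summable_mul_schurQ_add hx d) hL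

lemma hasKernelMean_nil {x : ℕ → ℝ} : HasKernelMean [] (schurQ x 0) := fun n => by
  simp [starSum, schurQ, kernelMean, kernelSum]

lemma hasKernelMean_replicate_two (m : ℕ) :
    HasKernelMean (List.replicate m 2) (schurQ (etaTerm m) 1) := by
  refine HasKernelSum.hasKernelMean (schurQ_succ_zero _ _) ?_
  convert hasKernelSum_nil.replicate_two_append m using 2 with i
  · rw [List.append_nil]
  · rw [schurQ_succ_sub, etaTerm, schurQ, schurQ]
    ring

lemma HasKernelMean.block321_append {l : List ℕ} {m d : ℕ} (hm : m ≠ 0)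
    (hl : HasKernelMean l (schurQ (etaTerm m) d)) :
    HasKernelMean (block321 m ++ l) (schurQ (etaTerm m) (d + 2)) := by
  obtain ⟨a, rfl⟩ := Nat.exists_eq_succ_of_ne_zero hm
  have hstep := hl.replicate_two_three_replicate_two_one_append a a (schurQ_succ_zero _ d)
    (schurQ_succ_sub _ d)
  refine HasKernelSum.hasKernelMean (schurQ_succ_zero _ _) ?_
  simpa [schurQ_succ_sub, block321] using hstep

/-! ### The three values in terms of `η(2m)` and `η(6m)` -/

/-- The Dirichlet eta value `η(2m)` for `m ≥ 1`; at `m = 0` the series diverges and this is `0`. -/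
noncomputable def etaValue (m : ℕ) : ℝ := ∑' i, etaTerm m i

lemma hasSum_neg_one_pow_mul {R : Type*} [Ring R] [TopologicalSpace R] [IsTopologicalRing R]
    {f : ℕ → R} {a b : R} (hf : HasSum f a) (heven : HasSum (fun n => f (2 * n)) b) :
    HasSum (fun n => (-1) ^ n * f n) (2 * b - a) := by
  have hinj : Function.Injective fun n : ℕ => 2 * n := mul_right_injective₀ two_ne_zero
  have hind := hasSum_subtype_iff_indicator.1 (hinj.hasSum_range_iff.2 heven)
  refine ((hind.mul_left 2).sub hf).congr_fun fun n => ?_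
  rcases Nat.even_or_odd' n with ⟨k, rfl | rfl⟩
  · rw [Set.indicator_of_mem (Set.mem_range_self k), pow_mul, neg_one_sq, one_pow]
    noncomm_ring
  · have hodd : 2 * k + 1 ∉ Set.range fun j : ℕ => 2 * j := by
      rintro ⟨j, hj⟩
      dsimp only at hj
      omega
    rw [Set.indicator_of_notMem hodd, pow_succ, pow_mul, neg_one_sq, one_pow]
    noncomm_ring

lemma hasSum_etaTerm_of_hasSum_zeta {m : ℕ} (hm : m ≠ 0) {Z : ℝ}
    (hZ : HasSum (fun n : ℕ => 1 / (n : ℝ) ^ (2 * m)) Z) :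
    HasSum (etaTerm m) ((1 - 2 / 2 ^ (2 * m)) * Z) := by
  have heven : HasSum (fun n : ℕ => 1 / ((2 * n : ℕ) : ℝ) ^ (2 * m)) (1 / 2 ^ (2 * m) * Z) :=
    (hZ.mul_left _).congr_fun fun n => by
      rw [Nat.cast_mul, mul_pow, Nat.cast_two, one_div_mul_one_div]
  have hshift := (hasSum_nat_add_iff' 1).2 (hasSum_neg_one_pow_mul hZ heven).neg
  have hvalue : -(2 * (1 / 2 ^ (2 * m) * Z) - Z) -
      ∑ n ∈ Finset.range 1, -((-1) ^ n * (1 / (n : ℝ) ^ (2 * m))) =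
      (1 - 2 / 2 ^ (2 * m)) * Z := by
    rw [Finset.sum_range_one, Nat.cast_zero, zero_pow (by omega)]
    ring
  rw [hvalue] at hshift
  refine hshift.congr_fun fun i => ?_
  rw [etaTerm]
  push_cast
  ring

lemma etaValue_eq {m : ℕ} (hm : m ≠ 0) :
    etaValue m = (-1) ^ (m + 1) * ((2 ^ (2 * m) - 2) * (bernoulli (2 * m) : ℝ) *
      Real.pi ^ (2 * m) / (2 * ((2 * m).factorial : ℝ))) := by
  have hpow : (2 : ℝ) ^ (2 * m) = 2 * 2 ^ (2 * m - 1) := (mul_pow_sub_one (by omega) 2).symm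
  rw [etaValue, (hasSum_etaTerm_of_hasSum_zeta hm (hasSum_zeta_nat hm)).tsum_eq, hpow]
  field_simp

lemma etaValue_three_mul {m : ℕ} (hm : m ≠ 0) :
    etaValue (3 * m) = (-1) ^ (m + 1) * ((2 ^ (6 * m) - 2) * (bernoulli (6 * m) : ℝ) *
      Real.pi ^ (6 * m) / (2 * ((6 * m).factorial : ℝ))) := by
  have hsign : (-1 : ℝ) ^ (3 * m + 1) = (-1) ^ (m + 1) := by
    rw [pow_succ, pow_mul, Odd.neg_one_pow (by decide), pow_succ]
  rw [etaValue_eq (by omega), hsign, show 2 * (3 * m) = 6 * m by ring]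

lemma hasSum_etaTerm {m : ℕ} (hm : m ≠ 0) : HasSum (etaTerm m) (etaValue m) :=
  (hasSum_etaTerm_of_hasSum_zeta hm (hasSum_zeta_nat hm)).summable.hasSum

lemma etaTerm_pow_three (m i : ℕ) : etaTerm m i ^ 3 = etaTerm (3 * m) i := by
  rw [etaTerm, etaTerm, div_pow, ← pow_mul, ← pow_mul, pow_mul' _ i 3]
  norm_num
  ring

lemma tendsto_sum_etaTerm {m : ℕ} (hm : m ≠ 0) :
    Tendsto (fun n => ∑ i ∈ Finset.range n, etaTerm m i) atTop (𝓝 (etaValue m)) :=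
  (hasSum_etaTerm hm).tendsto_sum_nat

lemma tendsto_sum_etaTerm_pow_three {m : ℕ} (hm : m ≠ 0) :
    Tendsto (fun n => ∑ i ∈ Finset.range n, etaTerm m i ^ 3) atTop (𝓝 (etaValue (3 * m))) := by
  simpa only [etaTerm_pow_three] using tendsto_sum_etaTerm (by omega : 3 * m ≠ 0)

lemma hasSum_mzsvTerm_block321 {m : ℕ} (hm : m ≠ 0) :
    HasSum (mzsvTerm (block321 m)) (2 * etaValue m ^ 2) := by
  have hrep := (hasKernelMean_nil (x := etaTerm m)).block321_append hm
  rw [List.append_nil] at hrep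
  refine hrep.hasSum_mzsvTerm_of_schurQ (hasSum_etaTerm hm).summable ?_
  simpa only [← schurQ_two] using ((tendsto_sum_etaTerm hm).pow 2).const_mul 2

lemma hasSum_mzsvTerm_block321_append_replicate_two {m : ℕ} (hm : m ≠ 0) :
    HasSum (mzsvTerm (block321 m ++ List.replicate m 2))
      ((4 * etaValue m ^ 3 + 2 * etaValue (3 * m)) / 3) := by
  have hrep := (hasKernelMean_replicate_two m).block321_append hm
  refine hrep.hasSum_mzsvTerm_of_schurQ (hasSum_etaTerm hm).summable ?_
  have hlim := (((tendsto_sum_etaTerm hm).pow 3).const_mul 4).add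
    ((tendsto_sum_etaTerm_pow_three hm).const_mul 2)
  simp only [← three_mul_schurQ_three] at hlim
  simpa using hlim.div_const 3

lemma hasSum_mzsvTerm_block321_append_block321 {m : ℕ} (hm : m ≠ 0) :
    HasSum (mzsvTerm (block321 m ++ block321 m))
      ((2 * etaValue m ^ 4 + 4 * etaValue m * etaValue (3 * m)) / 3) := by
  have hrep := ((hasKernelMean_nil (x := etaTerm m)).block321_append hm).block321_append hm
  rw [List.append_nil] at hrep
  refine hrep.hasSum_mzsvTerm_of_schurQ (hasSum_etaTerm hm).summable ?_
  have hlim := (((tendsto_sum_etaTerm hm).pow 4).const_mul 2).add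
    (((tendsto_sum_etaTerm hm).const_mul 4).mul (tendsto_sum_etaTerm_pow_three hm))
  simp only [← three_mul_schurQ_four] at hlim
  simpa using hlim.div_const 3

theorem mainTheorem8 (m : ℕ) (hm : 1 ≤ m) :
    (Summable (mzsvTerm (block321 m)) ∧
      mzsv (block321 m) =
        2 * Real.pi ^ (4 * m) *
          ((1 - 2 ^ (2 * m - 1)) * (bernoulli (2 * m) : ℝ) / ((2 * m).factorial : ℝ)) ^ 2) ∧
    (Summable (mzsvTerm (block321 m ++ List.replicate m 2)) ∧
      mzsv (block321 m ++ List.replicate m 2) =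
        (-1) ^ (m + 1) * (Real.pi ^ (6 * m) / 3) *
          ((2 ^ (2 * m) - 2) ^ 3 * (bernoulli (2 * m) : ℝ) ^ 3 /
              (2 * ((2 * m).factorial : ℝ) ^ 3) +
            (2 ^ (6 * m) - 2) * (bernoulli (6 * m) : ℝ) / ((6 * m).factorial : ℝ))) ∧
    (Summable (mzsvTerm (block321 m ++ block321 m)) ∧
      mzsv (block321 m ++ block321 m) =
        (2 - 2 ^ (2 * m)) * (bernoulli (2 * m) : ℝ) * Real.pi ^ (8 * m) /
            (3 * ((2 * m).factorial : ℝ)) *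
          ((1 - 2 ^ (2 * m - 1)) ^ 3 * (bernoulli (2 * m) : ℝ) ^ 3 /
              ((2 * m).factorial : ℝ) ^ 3 +
            (2 - 2 ^ (6 * m)) * (bernoulli (6 * m) : ℝ) / ((6 * m).factorial : ℝ))) := by
  have hm₀ : m ≠ 0 := Nat.one_le_iff_ne_zero.1 hm
  have hpow : (2 : ℝ) ^ (2 * m) = 2 * 2 ^ (2 * m - 1) := (mul_pow_sub_one (by omega) 2).symm
  have hfirst := hasSum_mzsvTerm_block321 hm₀
  have hsecond := hasSum_mzsvTerm_block321_append_replicate_two hm₀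
  have hthird := hasSum_mzsvTerm_block321_append_block321 hm₀
  rw [etaValue_eq hm₀] at hfirst hsecond hthird
  rw [etaValue_three_mul hm₀] at hsecond hthird
  refine ⟨⟨hfirst.summable, hfirst.tsum_eq.trans ?_⟩, ⟨hsecond.summable, hsecond.tsum_eq.trans ?_⟩,
    ⟨hthird.summable, hthird.tsum_eq.trans ?_⟩⟩
  all_goals
    rcases neg_one_pow_eq_or ℝ (m + 1) with hsign | hsign <;> rw [hsign, hpow] <;> ring
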